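/- For an integer $m\ge 1$ let $q=2^m$. For a fixed odd integer $n>1$ let $S_{n,m}=\{(a,a^n) : a\in\mathbb F_q\}\subseteq\mathbb F_q^2$ and let $\Gamma_{n,m}=\mathrm{Cay}(\mathbb F_q^2,\,S_{n,m}\setminus\{0\})$ be the graph with vertex set $\mathbb F_q^2$ in which $u$ and $v$ are adjacent if and only if $u-v\in S_{n,m}\setminus\{0\}$. Let $C_{n,m}\subseteq\mathbb F_2^{\mathbb F_q^2}$ be the binary linear code with parity-check matrix $A(\Gamma_{n,m})+I$ over $\mathbb F_2$, where $A(\Gamma_{n,m})$ is the adjacency matrix and $I$ the identity matrix. Its rate is $R(C_{n,m})=\dim_{\mathbb F_2}(C_{n,m})/q^2$. The generalized BCH family $F_n$ is the family of codes $C_{n,m}$ with $n\le 2^m-1$, and it is said to be of unit rate if $\lim_{m\to\infty}R(C_{n,m})=1$. For $h=\sum a_{i_1,i_2,j_1,j_2}\,x_1^{i_1}x_2^{i_2}y_1^{j_1}y_2^{j_2}\in\mathbb F_2[x_1,x_2,y_1,y_2]$ let $\mathrm{rank}(h)$ be the rank over $\mathbb F_2$ of its coefficient matrix $(a_{i_1,i_2,j_1,j_2})$,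 with rows indexed by $(i_1,i_2)$ and columns indexed by $(j_1,j_2)$. Put $d_n=(x_1+y_1)^n+x_2+y_2\in\mathbb F_2[x_1,x_2,y_1,y_2]$. Corollary. One has $$\mathrm{rank}(d_7^{\,2^6-1})=3256<4^6=4096,\qquad \mathrm{rank}(d_{11}^{\,2^7-1})=15018<4^7=16384,\qquad \mathrm{rank}(d_{13}^{\,2^7-1})=14442<4^7=16384,$$ and the generalized BCH families $F_7$, $F_{11}$ and $F_{13}$ are all of unit rate. -/

import Mathlib

open Filter Topology

namespace StorageCode

/-- The parity-check matrix `H = A(Γ) + I` over `𝔽₂` attached to a graph `Γ`. -/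
def parityCheck {V : Type*} [DecidableEq V] (Γ : SimpleGraph V) [DecidableRel Γ.Adj] :
    Matrix V V (ZMod 2) :=
  Γ.adjMatrix (ZMod 2) + 1

/-- The storage code on `Γ`: the binary linear code, with coordinates indexed by the vertices,
that has `A(Γ) + I` as a parity-check matrix, i.e. `{c | H c = 0}`. -/
def code {V : Type*} [Fintype V] [DecidableEq V] (Γ : SimpleGraph V) [DecidableRel Γ.Adj] :
    Submodule (ZMod 2) (V → ZMod 2) :=
  LinearMap.ker (parityCheck Γ).mulVecLin

/-- The rate of a linear code: its dimension over the dimension of the ambient space. -/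
noncomputable def rate {V : Type*} (C : Submodule (ZMod 2) (V → ZMod 2)) : ℝ :=
  (Module.finrank (ZMod 2) C : ℝ) / (Module.finrank (ZMod 2) (V → ZMod 2) : ℝ)

/-- The set `S = {(a, aⁿ) | a ∈ F} ⊆ F²`. -/
def powerCurve (F : Type*) [Field F] (n : ℕ) : Set (F × F) :=
  {v | ∃ a : F, v = (a, a ^ n)}

/-- The Cayley graph `Cay(F², S ∖ {0})`, where `S = {(a, aⁿ) | a ∈ F}`. -/
def bchGraph (F : Type*) [Field F] (n : ℕ) : SimpleGraph (F × F) :=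
  SimpleGraph.addCayley (powerCurve F n \ {0})

open Classical in
/-- The `m`-th member of the generalized BCH family `F_n`: the storage code on
`Cay(𝔽_q², S ∖ {0})`, where `q = 2 ^ m` and `S = {(a, aⁿ) | a ∈ 𝔽_q}`. -/
noncomputable def bchCode (n m : ℕ) :
    Submodule (ZMod 2) (GaloisField 2 m × GaloisField 2 m → ZMod 2) :=
  letI : Fintype (GaloisField 2 m) := Fintype.ofFinite _
  code (bchGraph (GaloisField 2 m) n)

/-- The family `F_n` is of unit rate: the rates of its members (defined for `m ≥ 1` with
`n ≤ 2 ^ m - 1`, hence for all large `m`) converge to `1` as `m → ∞`. -/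
def IsUnitRate (n : ℕ) : Prop :=
  Tendsto (fun m : ℕ => rate (bchCode n m)) atTop (𝓝 1)

/-- The ring `𝔽₂[x₁, x₂, y₁, y₂]`: `x₁, x₂` are the variables `Sum.inl 0, Sum.inl 1`, and
`y₁, y₂` are the variables `Sum.inr 0, Sum.inr 1`. -/
abbrev Poly : Type := MvPolynomial (Fin 2 ⊕ Fin 2) (ZMod 2)

/-- The coefficient matrix of `h`: the entry in row `(i₁, i₂)` and column `(j₁, j₂)` is the
coefficient of `x₁^i₁ x₂^i₂ y₁^j₁ y₂^j₂` in `h`. -/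
def coeffMatrix (h : Poly) : Matrix (Fin 2 →₀ ℕ) (Fin 2 →₀ ℕ) (ZMod 2) :=
  Matrix.of fun i j => MvPolynomial.coeff (Finsupp.sumElim i j) h

/-- The rank of a polynomial `h ∈ 𝔽₂[x₁, x₂, y₁, y₂]`: the rank of its coefficient matrix. -/
noncomputable def polyRank (h : Poly) : ℕ∞ := (coeffMatrix h).eRank

/-- The polynomial `d = (x₁ + y₁)ⁿ + x₂ + y₂`. -/
noncomputable def dPoly (n : ℕ) : Poly :=
  (MvPolynomial.X (Sum.inl 0) + MvPolynomial.X (Sum.inr 0)) ^ n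
    + MvPolynomial.X (Sum.inl 1) + MvPolynomial.X (Sum.inr 1)

end StorageCode

/-!
Give `x₁, y₁` the weight `1` and `x₂, y₂` the weight `n`. Then `d = (x₁ + y₁) ^ n + x₂ + y₂` is
homogeneous of weight `n`, and the coefficient matrix of `d ^ (2 ^ r - 1)` is block diagonal: a
column of weight `w` meets only rows of weight `n * (2 ^ r - 1) - w`. A block is determined by `w`,
and its rows and columns by the exponents of `y₂` and `x₂`, so a block has size at most
`2 ^ r × 2 ^ r`. Its entries are products of two binomial coefficients modulo `2`, which Lucas'
theorem expresses through binary digits. Hence the rank of `d ^ (2 ^ r - 1)` is the sum of the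
ranks of at most `n * 2 ^ r` small explicit matrices (`finrank_span_col`). Gaussian elimination on
rows encoded as natural numbers (`elimRank_eq_finrank`) computes that sum, `totalRank`, inside the
kernel.

For the rate, let `q = 2 ^ m`. Since `x ^ (q - 1)` is `1` for nonzero `x` in the field with `q`
elements, the parity-check matrix has entries `1 + d(u, v) ^ (q - 1)`. Say that a function of two
variables has separation rank at most `ρ` if it is a sum of `ρ` products of functions of one
variable (`HasSepRank`). This notion is submultiplicative, is preserved by the Frobenius
endomorphism, bounds the rank of the matrix of values, and for the values of a polynomial it is
bounded by the rank of the coefficient matrix (`hasSepRank_aeval`). As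
`2 ^ (r * k) - 1 = (2 ^ r - 1) * (1 + 2 ^ r + ⋯ + 2 ^ (r * (k - 1)))`, the rank of the parity-check
matrix is at most a constant times `ρ ^ (m / r)`, where `ρ = rank (d ^ (2 ^ r - 1))`. If
`ρ < 4 ^ r`, this is negligible against the length `4 ^ m` of the code, and the rate tends to `1`
(`isUnitRate_of_polyRank_lt`).
-/

namespace StorageCode

/-! ### A rank computation for the kernel -/

/-- `forceNat x k` is `k x`. Written as a case distinction on `x`, it makes kernel reduction evaluate
`x` to a literal before passing it to the continuation `k`. The functions below are written with
recursors, binary representation functions and continuations for the same reason. -/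
noncomputable def forceNat {α : Type} (x : ℕ) (k : ℕ → α) : α :=
  Nat.rec (k 0) (fun n _ => k (Nat.succ n)) x

/-- The number below `2 ^ len` whose `t`-th binary digit is `P t`. -/
noncomputable def bitMask (P : ℕ → Bool) (len : ℕ) : ℕ :=
  Nat.rec 0 (fun t ih => Bool.rec ih (Nat.lor ih (Nat.pow 2 t)) (P t)) len

/-- The binary digit of `x` at position `b`. -/
def bitAt (x b : ℕ) : Bool := Nat.beq (Nat.mod (Nat.shiftRight x b) 2) 1

/-- Passes the evaluated list `f 0, …, f (len - 1)`, followed by the accumulated list, to a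
continuation. -/
noncomputable def forceTable {α : Type} (f : ℕ → ℕ) (len : ℕ) : List ℕ → (List ℕ → α) → α :=
  Nat.rec (fun acc k => k acc) (fun t ih acc k => forceNat (f t) fun x => ih (x :: acc) k) len

/-- `selectAnd T a acc` is the bitwise conjunction of `acc` and those entries of `T` whose positions
are binary digits `1` of `a`. -/
noncomputable def selectAnd (T : List ℕ) : ℕ → ℕ → ℕ :=
  List.rec (fun _ acc => acc)
    (fun m _ ih a acc =>
      ih (Nat.div a 2) (Bool.rec acc (Nat.land acc m) (Nat.beq (Nat.mod a 2) 1))) T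

/-- One elimination step with pivot row `p` and pivot bit `b` (a power of two): adds `p` to the rows
of `L` that have the bit `b`, drops the rows that become zero, and passes on the others. -/
noncomputable def sweep (p b : ℕ) (L : List ℕ) : List ℕ → (List ℕ → ℕ) → ℕ :=
  List.rec (fun acc k => k acc)
    (fun v _ ih acc k =>
      Nat.rec (ih acc k) (fun m _ => ih (Nat.succ m :: acc) k)
        (Bool.rec (Nat.xor v p) v (Nat.beq (Nat.land v b) 0) : ℕ)) L

/-- The rank over `𝔽₂`, by Gaussian elimination, of a list of nonzero rows encoded in binary. The
argument `fuel` bounds the number of pivots. -/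
noncomputable def elimRank (fuel : ℕ) : List ℕ → ℕ :=
  Nat.rec (fun _ => 0)
    (fun _ ih L => List.rec 0
      (fun p L _ => forceNat (Nat.pow 2 (Nat.log2 p)) fun b => Nat.succ (sweep p b L [] ih)) L) fuel

/-- Passes to a continuation the nonzero numbers among `(A[d] &&& S[d]) >>> (i + d)`, added to
`out`. -/
noncomputable def blockRows (A : List ℕ) : List ℕ → ℕ → List ℕ → (List ℕ → ℕ) → ℕ :=
  List.rec (fun _ _ out k => k out)
    (fun a _ ih S i out k => List.rec (k out)
      (fun s S _ => Nat.rec (ih S (Nat.succ i) out k)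
        (fun m _ => ih S (Nat.succ i) (Nat.succ m :: out) k)
        (Nat.shiftRight (Nat.land a s) i)) S) A

/-- The sum of the ranks of the blocks of weights `w, w + n, w + 2 n, …` (`fuel` of them). The list
argument holds the masks of the weights `w - n, w - 2 n, …`, which are those that the rows of the
next block need. -/
noncomputable def classRank (T S : List ℕ) (n len full : ℕ) (fuel : ℕ) : ℕ → List ℕ → ℕ :=
  Nat.rec (fun _ _ => 0)
    (fun _ ih w acc => forceNat (selectAnd T w full) fun x =>
      Nat.add (blockRows (x :: acc) S 0 [] (elimRank len))
        (forceNat (Nat.add w n) fun w' => ih w' (x :: acc))) fuel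

/-- The sum of the ranks of all blocks of the coefficient matrix of `d ^ (2 ^ r - 1)`, where `bits`
is the number of binary digits to be used for exponents of `y₁`. The block of weight `w` occurs in
the class `c` of weights congruent to `w` modulo `n`; `T` and `S` hold the masks, over the values
`t` of the total exponent of `x₂` and `y₂`, from which the rows are formed. -/
noncomputable def totalRank (n r bits : ℕ) : ℕ :=
  forceNat (Nat.pow 2 r) fun len => forceNat (Nat.pred (Nat.pow 2 len)) fun full =>
  forceTable (fun b => bitMask (fun t => bitAt (Nat.mul n (Nat.sub (Nat.pred len) t)) b) len)
    bits [] fun T =>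
  forceTable (fun b => bitMask (fun t => bitAt t b) len) r [] fun R =>
  forceTable (fun i => selectAnd R i full) len [] fun S =>
  Nat.rec 0 (fun c ih => Nat.add ih (classRank T S n len full len c [])) n

/-! ### Correctness of the elimination -/

theorem forceNat_eq {α : Type} (x : ℕ) (k : ℕ → α) : forceNat x k = k x := by
  cases x <;> rfl

theorem testBit_bitMask (P : ℕ → Bool) (len t : ℕ) :
    (bitMask P len).testBit t = (decide (t < len) && P t) := by
  induction len with
  | zero => simp [bitMask]
  | succ n ih =>
    have h : bitMask P (n + 1) = bif P n then bitMask P n ||| 2 ^ n else bitMask P n := by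
      unfold bitMask
      cases h : P n <;> simp [h]
    rw [h]
    rcases lt_trichotomy t n with hlt | rfl | hgt
    · cases hP : P n <;> simp [ih, hlt, Nat.lt_succ_of_lt hlt, hlt.ne']
    · cases hP : P t <;> simp [ih]
    · cases hP : P n <;> simp [ih, hgt.not_gt, hgt.ne, hgt]

theorem forceTable_eq {α : Type} (f : ℕ → ℕ) (len : ℕ) (acc : List ℕ) (k : List ℕ → α) :
    forceTable f len acc k = k ((List.range len).map f ++ acc) := by
  induction len generalizing acc with
  | zero => rfl
  | succ n ih =>
    have h : forceTable f (n + 1) acc k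
        = forceNat (f n) fun x => forceTable f n (x :: acc) k := rfl
    rw [h, forceNat_eq, ih, List.range_succ]
    simp

theorem testBit_selectAnd (T : List ℕ) (a acc t : ℕ) :
    (selectAnd T a acc).testBit t = true ↔
      acc.testBit t = true ∧ ∀ b x, T[b]? = some x → a.testBit b = true → x.testBit t = true := by
  induction T generalizing a acc with
  | nil => simp [selectAnd]
  | cons m T ih =>
    have h : selectAnd (m :: T) a acc =
        selectAnd T (a / 2) (if a % 2 = 1 then acc &&& m else acc) := by
      change selectAnd T (a / 2) (Bool.rec (motive := fun _ => ℕ) acc (acc &&& m)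
        ((a % 2).beq 1)) = _
      rcases Nat.mod_two_eq_zero_or_one a with h0 | h0 <;> rw [h0] <;> rfl
    rw [h, ih]
    constructor
    · rintro ⟨h1, h2⟩
      have hacc : acc.testBit t = true ∧ (a.testBit 0 = true → m.testBit t = true) := by
        rcases Nat.mod_two_eq_zero_or_one a with h0 | h0 <;> simp_all
      refine ⟨hacc.1, fun b x hx hb => ?_⟩
      cases b with
      | zero => simp at hx; subst hx; exact hacc.2 hb
      | succ b => exact h2 b x (by simpa using hx) (by rwa [Nat.testBit_div_two])
    · rintro ⟨h1, h2⟩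
      refine ⟨?_, fun b x hx hb => h2 (b + 1) x (by simpa using hx) (by
        rwa [Nat.testBit_div_two] at hb)⟩
      have := h2 0 m (by simp)
      rcases Nat.mod_two_eq_zero_or_one a with h0 | h0 <;> simp_all

/-- The effect of an elimination step with pivot row `p` and pivot bit `b` on the row `v`. -/
def reduceBy (p b v : ℕ) : ℕ := if v &&& b = 0 then v else v ^^^ p

theorem sweep_eq (p b : ℕ) (L acc : List ℕ) (k : List ℕ → ℕ) :
    sweep p b L acc k = k (((L.map (reduceBy p b)).filter (· ≠ 0)).reverse ++ acc) := by
  induction L generalizing acc with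
  | nil => simp [sweep]
  | cons v L ih =>
    have h : sweep p b (v :: L) acc k
        = Nat.rec (sweep p b L acc k) (fun m _ => sweep p b L (m.succ :: acc) k)
          (reduceBy p b v) := by
      have hr : reduceBy p b v = Bool.rec (Nat.xor v p) v (Nat.beq (Nat.land v b) 0) := by
        show (if v &&& b = 0 then v else v ^^^ p) = Bool.rec (v ^^^ p) v (Nat.beq (v &&& b) 0)
        split_ifs with h
        · simp [h]
        · rw [show (v &&& b).beq 0 = false from Bool.eq_false_iff.2 fun h' => h (Nat.eq_of_beq_eq_true h')]
      rw [hr]; rfl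
    rw [h]
    rcases hv : reduceBy p b v with _ | m
    · simp [ih, hv]
    · simp [ih, hv]

/-- The vector over `𝔽₂` whose entries are the binary digits of `v`. -/
def bitVec (v : ℕ) : ℕ → ZMod 2 := fun j => if v.testBit j then 1 else 0

theorem bitVec_xor (a b : ℕ) : bitVec (a ^^^ b) = bitVec a + bitVec b := by
  ext j
  simp only [bitVec, Nat.testBit_xor, Pi.add_apply]
  cases a.testBit j <;> cases b.testBit j <;> simp; rfl

@[simp] theorem bitVec_zero : bitVec 0 = 0 := by
  ext j; simp [bitVec]

/-- Elimination of one pivot: subtracting multiples of `p` makes the remaining vectors lie in the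
kernel of `φ`, which meets the line through `p` only in `0`. -/
theorem finrank_span_insert_pivot {K V : Type*} [Field K] [AddCommGroup V] [Module K V]
    (φ : V →ₗ[K] K) {p : V} (hp : φ p = 1) {S : Set V} (hS : S.Finite) :
    Module.finrank K (Submodule.span K (insert p S)) =
      Module.finrank K (Submodule.span K ((fun v => v - φ v • p) '' S)) + 1 := by
  set S' := (fun v => v - φ v • p) '' S with hS'
  have h1 : Submodule.span K (insert p S) = Submodule.span K {p} ⊔ Submodule.span K S' := by
    rw [← Submodule.span_union]
    apply le_antisymm <;> rw [Submodule.span_le]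
    · rintro x (rfl | hx)
      · exact Submodule.subset_span (Or.inl rfl)
      · have h2 : x - φ x • p ∈ Submodule.span K ({p} ∪ S') :=
          Submodule.subset_span (Or.inr ⟨x, hx, rfl⟩)
        have h3 : p ∈ Submodule.span K ({p} ∪ S') := Submodule.subset_span (Or.inl rfl)
        simpa using Submodule.add_mem _ h2 (Submodule.smul_mem _ (φ x) h3)
    · have h3 : p ∈ Submodule.span K (insert p S) := Submodule.subset_span (Or.inl rfl)
      rintro x (rfl | ⟨y, hy, rfl⟩)
      · exact h3
      · exact Submodule.sub_mem _ (Submodule.subset_span (Or.inr hy)) (Submodule.smul_mem _ _ h3)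
  have hker : Submodule.span K S' ≤ LinearMap.ker φ := by
    rw [Submodule.span_le]
    rintro _ ⟨y, _, rfl⟩
    simp [hp]
  have hdisj : Submodule.span K {p} ⊓ Submodule.span K S' = ⊥ := by
    rw [eq_bot_iff]
    rintro x ⟨h1, h2⟩
    obtain ⟨c, rfl⟩ := Submodule.mem_span_singleton.1 h1
    have := hker h2
    simp [hp] at this
    simp [this]
  have hp0 : p ≠ 0 := by rintro rfl; simp at hp
  have : FiniteDimensional K (Submodule.span K S') :=
    FiniteDimensional.span_of_finite K (hS.image _)
  have := Submodule.finrank_sup_add_finrank_inf_eq (Submodule.span K {p}) (Submodule.span K S')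
  rw [hdisj, finrank_bot, finrank_span_singleton hp0, ← h1] at this
  omega

theorem bitVec_reduceBy (p v : ℕ) :
    bitVec (reduceBy p (2 ^ p.log2) v) = bitVec v - bitVec v p.log2 • bitVec p := by
  unfold reduceBy
  rw [Nat.and_two_pow]
  by_cases h : v.testBit p.log2 = true
  · rw [if_neg (by simp [h]), bitVec_xor, sub_eq_add_neg, ZModModule.neg_eq_self]
    simp [bitVec, h]
  · rw [if_pos (by simp [h])]
    simp [bitVec, h]

theorem span_image_filter_ne_zero (L : List ℕ) :
    Submodule.span (ZMod 2) (bitVec '' {v | v ∈ L.filter (· ≠ 0)}) =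
      Submodule.span (ZMod 2) (bitVec '' {v | v ∈ L}) := by
  apply le_antisymm <;> rw [Submodule.span_le]
  · rintro _ ⟨v, hv, rfl⟩
    exact Submodule.subset_span ⟨v, (List.mem_filter.1 hv).1, rfl⟩
  · rintro _ ⟨v, hv, rfl⟩
    by_cases h : v = 0
    · simp [h]
    · exact Submodule.subset_span ⟨v, List.mem_filter.2 ⟨hv, by simpa using h⟩, rfl⟩

/-- Gaussian elimination computes the rank, provided that no row is zero: the leading bit of the
first row then is a pivot. -/
theorem elimRank_eq_finrank (fuel : ℕ) (L : List ℕ) (hL : L.length ≤ fuel) (h0 : 0 ∉ L) :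
    elimRank fuel L = Module.finrank (ZMod 2) (Submodule.span (ZMod 2) (bitVec '' {v | v ∈ L})) := by
  induction fuel generalizing L with
  | zero =>
    obtain rfl : L = [] := by simpa using hL
    rw [show {v : ℕ | v ∈ ([] : List ℕ)} = ∅ by simp, Set.image_empty, Submodule.span_empty, finrank_bot]
    rfl
  | succ fuel ih =>
    cases L with
    | nil =>
      rw [show {v : ℕ | v ∈ ([] : List ℕ)} = ∅ by simp, Set.image_empty, Submodule.span_empty, finrank_bot]
      rfl
    | cons p L =>
      have h : elimRank (fuel + 1) (p :: L) =
          forceNat (2 ^ p.log2) fun b => (sweep p b L [] (elimRank fuel)).succ := rfl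
      have hp : p ≠ 0 := by rintro rfl; simp at h0
      rw [h, forceNat_eq, sweep_eq, List.append_nil, ih]
      · have e1 : {v | v ∈ p :: L} = insert p {v | v ∈ L} := by ext; simp
        rw [e1, Set.image_insert_eq, finrank_span_insert_pivot (LinearMap.proj p.log2) _
          ((List.finite_toSet L).image _)]
        · have e2 (M : List ℕ) : {v | v ∈ M.reverse} = {v | v ∈ M} := by ext; simp
          have e3 : bitVec '' {v | v ∈ L.map (reduceBy p (2 ^ p.log2))} =
              (fun v => v - LinearMap.proj (R := ZMod 2) (φ := fun _ : ℕ => ZMod 2) p.log2 v •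
                bitVec p) '' (bitVec '' {v | v ∈ L}) := by
            ext x
            simp [bitVec_reduceBy]
          rw [e2, span_image_filter_ne_zero, e3]
        · simp [bitVec, Nat.testBit_log2 hp]
      · simp only [List.length_reverse]
        refine (List.length_filter_le _ _).trans ?_
        simpa using hL
      · simp

/-- The list that `blockRows` passes to its continuation. -/
def blockRowsList : List ℕ → List ℕ → ℕ → List ℕ → List ℕ
  | [], _, _, out => out
  | _ :: _, [], _, out => out
  | a :: A, s :: S, i, out =>
    blockRowsList A S (i + 1) (if (a &&& s) >>> i = 0 then out else (a &&& s) >>> i :: out)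

theorem blockRows_eq (A S : List ℕ) (i : ℕ) (out : List ℕ) (k : List ℕ → ℕ) :
    blockRows A S i out k = k (blockRowsList A S i out) := by
  induction A generalizing S i out with
  | nil => rfl
  | cons a A ih =>
    cases S with
    | nil => rfl
    | cons s S =>
      have h : blockRows (a :: A) (s :: S) i out k
          = Nat.rec (blockRows A S (i + 1) out k)
            (fun m _ => blockRows A S (i + 1) (m.succ :: out) k) ((a &&& s) >>> i) := rfl
      rw [h, blockRowsList]
      rcases (a &&& s) >>> i with _ | m <;> simp [ih]

theorem mem_blockRowsList (A S : List ℕ) (i : ℕ) (out : List ℕ) (v : ℕ) :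
    v ∈ blockRowsList A S i out ↔ v ∈ out ∨ v ≠ 0 ∧
      ∃ d a s, A[d]? = some a ∧ S[d]? = some s ∧ v = (a &&& s) >>> (i + d) := by
  induction A generalizing S i out with
  | nil => simp [blockRowsList]
  | cons a A ih =>
    cases S with
    | nil => simp [blockRowsList]
    | cons s S =>
      rw [blockRowsList, ih]
      constructor
      · rintro (h | ⟨hv, d, a', s', h1, h2, h3⟩)
        · split_ifs at h with h0
          · exact Or.inl h
          · rcases List.mem_cons.1 h with rfl | h
            · exact Or.inr ⟨h0, 0, a, s, by simp, by simp, by simp⟩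
            · exact Or.inl h
        · exact Or.inr ⟨hv, d + 1, a', s', by simpa using h1, by simpa using h2, by
            rw [h3]; congr 1; omega⟩
      · rintro (h | ⟨hv, d, a', s', h1, h2, h3⟩)
        · left; split_ifs <;> simp [h]
        · cases d with
          | zero =>
            simp at h1 h2 h3; subst h1 h2 h3
            left; rw [if_neg hv]; simp
          | succ d => exact Or.inr ⟨hv, d, a', s', by simpa using h1, by simpa using h2, by
              rw [h3]; congr 1; omega⟩

theorem length_blockRowsList_le (A S : List ℕ) (i : ℕ) (out : List ℕ) :
    (blockRowsList A S i out).length ≤ S.length + out.length := by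
  induction A generalizing S i out with
  | nil => simp [blockRowsList]
  | cons a A ih =>
    cases S with
    | nil => simp [blockRowsList]
    | cons s S =>
      refine (ih _ _ _).trans ?_
      split_ifs <;> simp; omega

/-- The list of masks after `k` steps is the reversed list of the masks of `c, c + n, …`, so that
its `i`-th entry belongs to the weight `n * i` below the current one. -/
theorem classRank_eq (T S : List ℕ) (n len full c fuel k : ℕ) :
    classRank T S n len full fuel (c + n * k)
      (((List.range k).map fun l => selectAnd T (c + n * l) full).reverse) =
    ∑ l ∈ Finset.range fuel, elimRank len (blockRowsList
      (((List.range (k + l + 1)).map fun l => selectAnd T (c + n * l) full).reverse) S 0 []) := by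
  induction fuel generalizing k with
  | zero => rfl
  | succ fuel ih =>
    have h (w : ℕ) (acc : List ℕ) : classRank T S n len full (fuel + 1) w acc =
        forceNat (selectAnd T w full) fun x =>
          blockRows (x :: acc) S 0 [] (elimRank len) +
          (forceNat (w + n) fun w' => classRank T S n len full fuel w' (x :: acc)) := rfl
    rw [h, forceNat_eq, forceNat_eq, blockRows_eq, Finset.sum_range_succ']
    have hl : selectAnd T (c + n * k) full ::
        ((List.range k).map fun l => selectAnd T (c + n * l) full).reverse =
        ((List.range (k + 1)).map fun l => selectAnd T (c + n * l) full).reverse := by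
      simp [List.range_succ]
    rw [hl, show c + n * k + n = c + n * (k + 1) by ring, ih, add_comm]
    simp only [add_zero, add_assoc, add_comm 1]

/-! ### The blocks as matrices of binomial coefficients -/

/-- Lucas' theorem for the prime `2`, in terms of binary digits. -/
theorem odd_choose_iff_testBit (x a : ℕ) :
    Odd (x.choose a) ↔ ∀ b, a.testBit b = true → x.testBit b = true := by
  induction x using Nat.strong_induction_on generalizing a with
  | _ x ih =>
  have hprime : Fact (Nat.Prime 2) := ⟨Nat.prime_two⟩
  have hluc := Choose.choose_modEq_choose_mod_mul_choose_div_nat (n := x) (k := a) (p := 2)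
  have hbits : (∀ b, a.testBit b = true → x.testBit b = true) ↔
      (a.testBit 0 = true → x.testBit 0 = true) ∧
        ∀ b, (a / 2).testBit b = true → (x / 2).testBit b = true := by
    simp only [Nat.testBit_div_two]
    constructor
    · exact fun h => ⟨h 0, fun b => h (b + 1)⟩
    · rintro ⟨h0, h1⟩ (_ | b)
      exacts [h0, h1 b]
  have hlow : Odd ((x % 2).choose (a % 2)) ↔ (a.testBit 0 = true → x.testBit 0 = true) := by
    rcases Nat.mod_two_eq_zero_or_one x with h | h <;>
      rcases Nat.mod_two_eq_zero_or_one a with h' | h' <;> simp [h, h', Nat.testBit_zero]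
  rcases Nat.eq_zero_or_pos x with rfl | hx
  · rcases Nat.eq_zero_or_pos a with rfl | ha
    · simp
    · rw [Nat.choose_eq_zero_of_lt ha]
      simp only [Nat.not_odd_zero, Nat.zero_testBit, false_iff]
      intro h
      exact absurd (h _ (Nat.testBit_log2 ha.ne')) (by simp)
  · rw [hbits, ← ih _ (Nat.div_lt_self hx one_lt_two), ← hlow, ← Nat.odd_mul, Nat.odd_iff,
      Nat.odd_iff, hluc]

theorem bitAt_eq_testBit (x b : ℕ) : bitAt x b = x.testBit b := by
  change Nat.beq ((x >>> b) % 2) 1 = x.testBit b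
  rw [Nat.testBit_eq_decide_div_mod_eq, Nat.shiftRight_eq_div_pow]
  rcases Nat.mod_two_eq_zero_or_one (x / 2 ^ b) with h | h <;> rw [h] <;> rfl

/-- The `b`-th entry, for `b < B`, is the mask of the `t < len` for which `g t` has the binary
digit `1` at position `b`. -/
noncomputable def bitTable (g : ℕ → ℕ) (B len : ℕ) : List ℕ :=
  (List.range B).map fun b => bitMask (fun t => bitAt (g t) b) len

/-- By Lucas' theorem, the conjunction of the masks selected by `a` is the mask of the `t` for
which `(g t).choose a` is odd. -/
theorem testBit_selectAnd_bitTable (g : ℕ → ℕ) (B len a t : ℕ) (ha : a < 2 ^ B) :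
    (selectAnd (bitTable g B len) a (2 ^ len - 1)).testBit t = true ↔
      t < len ∧ Odd ((g t).choose a) := by
  rw [testBit_selectAnd, odd_choose_iff_testBit, Nat.testBit_two_pow_sub_one, decide_eq_true_iff]
  refine and_congr_right fun ht => ⟨fun h b hb => ?_, fun h b x hx hb => ?_⟩
  · have hbB : b < B := by
      by_contra hB
      rw [Nat.testBit_lt_two_pow (ha.trans_le (Nat.pow_le_pow_right two_pos (not_lt.1 hB)))] at hb
      simp at hb
    have := h b _ (by simp [bitTable, hbB]; rfl) hb
    rw [testBit_bitMask, bitAt_eq_testBit] at this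
    simpa [ht] using this
  · simp only [bitTable, List.getElem?_map, Option.map_eq_some_iff] at hx
    obtain ⟨b', hb', rfl⟩ := hx
    obtain ⟨hB, rfl⟩ := List.getElem?_eq_some_iff.1 hb'
    rw [testBit_bitMask, bitAt_eq_testBit]
    simpa [ht] using h b hb

/-- The entries of the block of weight `w` of the coefficient matrix of `d ^ (2 ^ r - 1)`: that of
the monomial with `y₁`, `y₂`, `x₂` to the powers `w - n * i`, `i`, `j` (the power of `x₁` is then
determined). The subtraction `w - n * i` is meant for `n * i ≤ w`. -/
def blockEntry (n r w i j : ℕ) : ZMod 2 :=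
  if i + j < 2 ^ r then
    ((n * (2 ^ r - 1 - (i + j))).choose (w - n * i) : ZMod 2) * ((i + j).choose i : ZMod 2)
  else 0

/-- The nonzero rows of the block of weight `c + n * k`, encoded in binary. -/
noncomputable def blockList (n r bits c k : ℕ) : List ℕ :=
  blockRowsList (((List.range (k + 1)).map fun l =>
      selectAnd (bitTable (fun t => n * (2 ^ r - 1 - t)) bits (2 ^ r)) (c + n * l)
        (2 ^ 2 ^ r - 1)).reverse)
    ((List.range (2 ^ r)).map fun i =>
      selectAnd (bitTable (fun t => t) r (2 ^ r)) i (2 ^ 2 ^ r - 1)) 0 []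

/-- The mask of the row `i` is formed over the values `t = i + j`, so it is shifted by `i` to become
a mask over the columns `j`. -/
theorem span_blockList {n r bits c k : ℕ} (hbits : n * 2 ^ r ≤ 2 ^ bits) (hc : c < n)
    (hk : k < 2 ^ r) :
    Submodule.span (ZMod 2) (bitVec '' {v | v ∈ blockList n r bits c k}) =
      Submodule.span (ZMod 2) ((fun i => blockEntry n r (c + n * k) i) '' Set.Iic k) := by
  have key (i : ℕ) (hi : i ≤ k) : bitVec ((selectAnd (bitTable (fun t => n * (2 ^ r - 1 - t)) bits
      (2 ^ r)) (c + n * (k - i)) (2 ^ 2 ^ r - 1) &&& selectAnd (bitTable (fun t => t) r (2 ^ r)) i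
        (2 ^ 2 ^ r - 1)) >>> i) = blockEntry n r (c + n * k) i := by
    have hw : c + n * (k - i) < 2 ^ bits := by
      refine lt_of_lt_of_le ?_ hbits
      calc c + n * (k - i) < n + n * k := by
            have : n * (k - i) ≤ n * k := Nat.mul_le_mul_left _ (Nat.sub_le _ _)
            omega
        _ = n * (k + 1) := by ring
        _ ≤ n * 2 ^ r := Nat.mul_le_mul_left _ hk
    have hw' : c + n * k - n * i = c + n * (k - i) := by
      rw [Nat.mul_sub, Nat.add_sub_assoc (Nat.mul_le_mul_left _ hi)]
    ext j
    have hodd (x : ℕ) : (x : ZMod 2) = if Odd x then 1 else 0 := by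
      split_ifs with h
      · exact (ZMod.natCast_eq_one_iff_odd).2 h
      · exact (ZMod.natCast_eq_zero_iff_even).2 (Nat.not_odd_iff_even.1 h)
    simp only [bitVec, blockEntry, Nat.testBit_shiftRight, Nat.testBit_and, Bool.and_eq_true,
      testBit_selectAnd_bitTable _ _ _ _ _ hw,
      testBit_selectAnd_bitTable _ _ _ _ _ (lt_of_le_of_lt hi hk), hw']
    rw [hodd, hodd]
    split_ifs <;> simp_all
  apply le_antisymm <;> rw [Submodule.span_le]
  · rintro _ ⟨v, hv, rfl⟩
    obtain h | ⟨-, d, a, s, ha, hs, rfl⟩ := (mem_blockRowsList _ _ _ _ _).1 hv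
    · simp at h
    · rw [List.getElem?_eq_some_iff] at ha hs
      obtain ⟨hd, rfl⟩ := ha
      obtain ⟨hd', rfl⟩ := hs
      simp at hd hd'
      refine Submodule.subset_span ⟨d, hd, ?_⟩
      dsimp only
      rw [← key d hd]
      simp
  · rintro _ ⟨i, hi, rfl⟩
    simp only [Set.mem_Iic] at hi
    dsimp only
    rw [← key i hi]
    set v := (selectAnd _ _ _ &&& _) >>> i with hv
    by_cases h0 : v = 0
    · simp [h0]
    · refine Submodule.subset_span ⟨v, (mem_blockRowsList _ _ _ _ _).2 (Or.inr ⟨h0, i, _, _,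
        List.getElem?_eq_some_iff.2 ⟨by simp; omega, rfl⟩,
        List.getElem?_eq_some_iff.2 ⟨by simp; omega, rfl⟩, ?_⟩), rfl⟩
      rw [hv]
      simp

theorem totalRank_eq (n r bits : ℕ) (hbits : n * 2 ^ r ≤ 2 ^ bits) :
    totalRank n r bits = ∑ c ∈ Finset.range n, ∑ k ∈ Finset.range (2 ^ r),
      Module.finrank (ZMod 2) (Submodule.span (ZMod 2)
        ((fun i => blockEntry n r (c + n * k) i) '' Set.Iic k)) := by
  have h : totalRank n r bits = ∑ c ∈ Finset.range n, ∑ k ∈ Finset.range (2 ^ r),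
      elimRank (2 ^ r) (blockList n r bits c k) := by
    have hrec (f : ℕ → ℕ) (m : ℕ) :
        Nat.rec (motive := fun _ => ℕ) 0 (fun c ih => Nat.add ih (f c)) m =
          ∑ c ∈ Finset.range m, f c := by
      induction m with
      | zero => rfl
      | succ m ih => rw [Finset.sum_range_succ, ← ih]; rfl
    unfold totalRank
    simp only [forceNat_eq, forceTable_eq, List.append_nil]
    refine (hrec _ n).trans (Finset.sum_congr rfl fun c _ => ?_)
    refine (classRank_eq _ _ n (2 ^ r) _ c (2 ^ r) 0).trans (Finset.sum_congr rfl fun k _ => ?_)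
    rw [zero_add]
    rfl
  rw [h]
  refine Finset.sum_congr rfl fun c hc => Finset.sum_congr rfl fun k hk => ?_
  rw [← span_blockList hbits (Finset.mem_range.1 hc) (Finset.mem_range.1 hk),
    elimRank_eq_finrank]
  · refine (length_blockRowsList_le _ _ _ _).trans (by simp)
  · intro h0
    simpa using (mem_blockRowsList _ _ _ _ _).1 h0

/-! ### The coefficient matrix and its blocks -/

theorem X_add_X_pow {σ R : Type*} [CommSemiring R] (p q : σ) (m : ℕ) :
    (MvPolynomial.X p + MvPolynomial.X q : MvPolynomial σ R) ^ m =
      ∑ e ∈ Finset.range (m + 1), MvPolynomial.monomial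
        (Finsupp.single p e + Finsupp.single q (m - e)) (m.choose e : R) := by
  rw [add_pow]
  refine Finset.sum_congr rfl fun e _ => ?_
  rw [MvPolynomial.X_pow_eq_monomial, MvPolynomial.X_pow_eq_monomial, MvPolynomial.monomial_mul,
    mul_one, ← map_natCast (MvPolynomial.C (σ := σ) (R := R)), mul_comm, MvPolynomial.C_mul_monomial,
    mul_one]

theorem coeff_pow_mul_pow (t s : ℕ) (i j : Fin 2 →₀ ℕ) :
    MvPolynomial.coeff (Finsupp.sumElim i j)
      ((MvPolynomial.X (Sum.inr 1) + MvPolynomial.X (Sum.inl 1)) ^ t *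
        (MvPolynomial.X (Sum.inr 0) + MvPolynomial.X (Sum.inl 0)) ^ s : Poly) =
      if i 1 + j 1 = t ∧ i 0 + j 0 = s then (t.choose (j 1) : ZMod 2) * (s.choose (j 0) : ZMod 2)
      else 0 := by
  rw [X_add_X_pow, X_add_X_pow, Finset.sum_mul_sum]
  simp only [MvPolynomial.monomial_mul, MvPolynomial.coeff_sum, MvPolynomial.coeff_monomial]
  have hiff (e b : ℕ) : (Finsupp.single (Sum.inr 1) e + Finsupp.single (Sum.inl 1) (t - e) +
      (Finsupp.single (Sum.inr 0) b + Finsupp.single (Sum.inl 0) (s - b)) : Fin 2 ⊕ Fin 2 →₀ ℕ) =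
      Finsupp.sumElim i j ↔ (j 1 = e ∧ i 1 = t - e) ∧ (j 0 = b ∧ i 0 = s - b) := by
    rw [DFunLike.ext_iff]
    simp only [Sum.forall, Fin.forall_fin_two]
    simp
    grind
  simp only [hiff]
  split_ifs with h
  · rw [Finset.sum_eq_single (j 1), Finset.sum_eq_single (j 0), if_pos]
    · omega
    · intro b _ hb; rw [if_neg]; tauto
    · intro hb; simp at hb; omega
    · intro b _ hb; refine Finset.sum_eq_zero fun _ _ => ?_; rw [if_neg]; tauto
    · intro hb; simp at hb; omega
  · refine Finset.sum_eq_zero fun e he => Finset.sum_eq_zero fun b hb => if_neg ?_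
    simp at he hb
    omega

/-- The binomial expansion of `d ^ Q` in powers of `x₂ + y₂` and of `(x₁ + y₁) ^ n`, in which only
the term with the power `i 1 + j 1` of `x₂ + y₂` contributes. -/
theorem coeffMatrix_dPoly_pow (n Q : ℕ) (i j : Fin 2 →₀ ℕ) :
    coeffMatrix (dPoly n ^ Q) i j =
      if i 1 + j 1 ≤ Q ∧ i 0 + j 0 = n * (Q - (i 1 + j 1)) then
        (Q.choose (i 1 + j 1) : ZMod 2) * (((i 1 + j 1).choose (j 1) : ZMod 2) *
          ((n * (Q - (i 1 + j 1))).choose (j 0) : ZMod 2))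
      else 0 := by
  have h : dPoly n = (MvPolynomial.X (Sum.inr 1) + MvPolynomial.X (Sum.inl 1)) +
      (MvPolynomial.X (Sum.inr 0) + MvPolynomial.X (Sum.inl 0)) ^ n := by
    unfold dPoly; ring
  rw [coeffMatrix, Matrix.of_apply, h, add_pow]
  simp only [← pow_mul, MvPolynomial.coeff_sum]
  have hc (p : Poly) (m : ℕ) (d) :
      MvPolynomial.coeff d (p * (m : Poly)) = (m : ZMod 2) * MvPolynomial.coeff d p := by
    rw [← map_natCast (MvPolynomial.C (σ := Fin 2 ⊕ Fin 2) (R := ZMod 2)), mul_comm,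
      MvPolynomial.coeff_C_mul]
  simp only [hc, coeff_pow_mul_pow]
  split_ifs with h
  · rw [Finset.sum_eq_single (i 1 + j 1), if_pos ⟨rfl, h.2⟩]
    · intro t _ ht; rw [if_neg, mul_zero]; tauto
    · intro hb; simp at hb; omega
  · refine Finset.sum_eq_zero fun t ht => ?_
    rw [if_neg, mul_zero]
    rintro ⟨rfl, h2⟩
    simp at ht
    exact h ⟨by omega, h2⟩

theorem choose_two_pow_sub_one {r t : ℕ} (ht : t < 2 ^ r) : ((2 ^ r - 1).choose t : ZMod 2) = 1 := by
  rw [ZMod.natCast_eq_one_iff_odd, odd_choose_iff_testBit]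
  intro b hb
  rw [Nat.testBit_two_pow_sub_one, decide_eq_true_iff]
  by_contra hr
  rw [Nat.testBit_lt_two_pow (ht.trans_le (Nat.pow_le_pow_right two_pos (not_lt.1 hr)))] at hb
  simp at hb

/-- If `x₁, y₁` have weight `1` and `x₂, y₂` have weight `n`, then `d ^ (2 ^ r - 1)` is homogeneous
of weight `n * (2 ^ r - 1)`. The column `j` of weight `w` thus meets only the rows of the
complementary weight, where it coincides with the row `j 1` of the block of weight `w`. -/
theorem coeffMatrix_eq_blockEntry {n r : ℕ} {i j : Fin 2 →₀ ℕ}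
    (h : i 0 + n * i 1 + (j 0 + n * j 1) = n * (2 ^ r - 1)) :
    coeffMatrix (dPoly n ^ (2 ^ r - 1)) i j = blockEntry n r (j 0 + n * j 1) (j 1) (i 1) := by
  have hpos : 0 < 2 ^ r := by positivity
  rw [coeffMatrix_dPoly_pow, blockEntry, add_comm (j 1), Nat.add_sub_cancel]
  by_cases ht : i 1 + j 1 < 2 ^ r
  · have hle : i 1 + j 1 ≤ 2 ^ r - 1 := by omega
    have heq : i 0 + j 0 = n * (2 ^ r - 1 - (i 1 + j 1)) := by
      rw [Nat.mul_sub, mul_add]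
      omega
    rw [if_pos ⟨hle, heq⟩, if_pos ht, choose_two_pow_sub_one ht, one_mul, mul_comm]
  · rw [if_neg ht, if_neg]
    omega

theorem coeffMatrix_eq_zero {n r : ℕ} {i j : Fin 2 →₀ ℕ}
    (h : i 0 + n * i 1 + (j 0 + n * j 1) ≠ n * (2 ^ r - 1)) :
    coeffMatrix (dPoly n ^ (2 ^ r - 1)) i j = 0 := by
  rw [coeffMatrix_dPoly_pow, if_neg]
  rintro ⟨h1, h2⟩
  apply h
  have := Nat.mul_le_mul_left n h1
  rw [mul_add] at this
  rw [Nat.mul_sub, mul_add] at h2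
  omega

theorem blockEntry_eq_zero {n r w i j : ℕ} (hi : n * i ≤ w) (h : n * (2 ^ r - 1) < w + n * j) :
    blockEntry n r w i j = 0 := by
  rw [blockEntry]
  split_ifs with hij
  · rw [Nat.choose_eq_zero_of_lt (n := n * (2 ^ r - 1 - (i + j))), Nat.cast_zero, zero_mul]
    have : n * (i + j) ≤ n * (2 ^ r - 1) := Nat.mul_le_mul_left _ (by omega)
    generalize 2 ^ r - 1 = Q at *
    rw [Nat.mul_sub, mul_add]
    rw [mul_add] at this
    omega
  · rfl

theorem finrank_pi_submodule {K ι : Type*} [Field K] [Fintype ι] {M : Type*}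
    [AddCommGroup M] [Module K M] (p : ι → Submodule K M) [∀ i, FiniteDimensional K (p i)] :
    Module.finrank K (Submodule.pi Set.univ p) = ∑ i, Module.finrank K (p i) := by
  rw [← Module.finrank_pi_fintype K]
  refine LinearEquiv.finrank_eq
    { toFun := fun f i => ⟨f.1 i, f.2 i trivial⟩
      invFun := fun f => ⟨fun i => f i, fun i _ => (f i).2⟩
      map_add' := fun _ _ => rfl
      map_smul' := fun _ _ => rfl
      left_inv := fun _ => rfl
      right_inv := fun _ => rfl }

/-- Rearranges a vector indexed by exponents `(i₁, i₂)` into blocks: its entry at weight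
`n * (2 ^ r - 1) - w`, `i₂ = m` is put at position `m` of block `w`. The block `w = c + n * k` is
indexed by the pair `(c, k)`. -/
noncomputable def blockMap (n r : ℕ) : ((Fin 2 →₀ ℕ) → ZMod 2) →ₗ[ZMod 2]
    (Fin n × Fin (2 ^ r) → ℕ → ZMod 2) where
  toFun f b m :=
    if b.1 + n * b.2 + n * m ≤ n * (2 ^ r - 1) then
      f (Finsupp.equivFunOnFinite.symm ![n * (2 ^ r - 1) - (b.1 + n * b.2 + n * m), m])
    else 0
  map_add' f g := by ext; simp only [Pi.add_apply]; split_ifs <;> simp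
  map_smul' a f := by ext; simp only [Pi.smul_apply]; split_ifs <;> simp

theorem blockMap_col (n r : ℕ) (j : Fin 2 →₀ ℕ) (b : Fin n × Fin (2 ^ r)) :
    blockMap n r ((coeffMatrix (dPoly n ^ (2 ^ r - 1))).col j) b =
      if j 0 + n * j 1 = b.1 + n * b.2 then blockEntry n r (b.1 + n * b.2) (j 1) else 0 := by
  ext m
  simp only [blockMap, LinearMap.coe_mk, AddHom.coe_mk, Matrix.col_apply]
  split_ifs with h1 h2 h2
  · rw [coeffMatrix_eq_blockEntry, h2]
    · simp
    · simp; omega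
  · rw [coeffMatrix_eq_zero, Pi.zero_apply]
    simp; omega
  · rw [blockEntry_eq_zero] <;> omega
  · rfl

/-- The coefficient matrix is block diagonal, so its rank is the sum of the ranks of its blocks. -/
theorem finrank_span_col (n r : ℕ) (hn : 0 < n) :
    Module.finrank (ZMod 2) (Submodule.span (ZMod 2)
      (Set.range (coeffMatrix (dPoly n ^ (2 ^ r - 1))).col)) =
    ∑ c ∈ Finset.range n, ∑ k ∈ Finset.range (2 ^ r),
      Module.finrank (ZMod 2) (Submodule.span (ZMod 2)
        ((fun i => blockEntry n r (c + n * k) i) '' Set.Iic k)) := by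
  have hpos : 0 < 2 ^ r := by positivity
  set A := coeffMatrix (dPoly n ^ (2 ^ r - 1)) with hA
  set S := Submodule.span (ZMod 2) (Set.range A.col) with hS
  -- the columns vanish at the rows of weight above `n (2 ^ r - 1)`, so `blockMap` is injective
  have hvan : ∀ f ∈ S, ∀ i : Fin 2 →₀ ℕ, n * (2 ^ r - 1) < i 0 + n * i 1 → f i = 0 := by
    intro f hf i hi
    have : S ≤ LinearMap.ker (LinearMap.proj (R := ZMod 2) (φ := fun _ => ZMod 2) i) := by
      rw [hS, Submodule.span_le]
      rintro _ ⟨j, rfl⟩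
      exact coeffMatrix_eq_zero (by omega)
    exact this hf
  have hinj : Function.Injective ((blockMap n r).domRestrict S) := by
    rw [← LinearMap.ker_eq_bot, LinearMap.ker_eq_bot']
    rintro ⟨f, hf⟩ h0
    ext i
    rcases lt_or_ge (n * (2 ^ r - 1)) (i 0 + n * i 1) with hi | hi
    · exact hvan f hf i hi
    · set w := n * (2 ^ r - 1) - (i 0 + n * i 1) with hw
      have hwk : w / n < 2 ^ r := by
        rw [Nat.div_lt_iff_lt_mul hn]
        calc w ≤ n * (2 ^ r - 1) := Nat.sub_le _ _
          _ < 2 ^ r * n := by rw [mul_comm]; exact Nat.mul_lt_mul_of_pos_right (by omega) hn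
      have := congrFun (congrFun h0 (⟨w % n, Nat.mod_lt _ hn⟩, ⟨w / n, hwk⟩)) (i 1)
      simp only [LinearMap.domRestrict_apply, blockMap, LinearMap.coe_mk, AddHom.coe_mk,
        Nat.mod_add_div] at this
      rw [if_pos (by omega)] at this
      convert! this using 2
      ext x
      fin_cases x
      · simp; omega
      · simp
  let p : Fin n × Fin (2 ^ r) → Submodule (ZMod 2) (ℕ → ZMod 2) := fun b =>
    Submodule.span (ZMod 2)
        ((fun i => blockEntry n r (b.1 + n * b.2) i) '' Set.Iic (b.2 : ℕ))
  have hfin (b) : FiniteDimensional (ZMod 2) (p b) :=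
    FiniteDimensional.span_of_finite _ ((Set.finite_Iic _).image _)
  have hrange : LinearMap.range ((blockMap n r).domRestrict S) = Submodule.pi Set.univ p := by
    rw [LinearMap.range_domRestrict, hS, Submodule.map_span, ← Submodule.iSup_map_single]
    apply le_antisymm
    · rw [Submodule.span_le]
      rintro _ ⟨_, ⟨j, rfl⟩, rfl⟩
      have hcol := blockMap_col n r j
      rw [← hA] at hcol
      by_cases hw : (j 0 + n * j 1) / n < 2 ^ r
      · set b : Fin n × Fin (2 ^ r) := (⟨(j 0 + n * j 1) % n, Nat.mod_lt _ hn⟩, ⟨_, hw⟩) with hb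
        have hbw : (b.1 : ℕ) + n * b.2 = j 0 + n * j 1 := Nat.mod_add_div _ _
        refine Submodule.mem_iSup_of_mem b ⟨blockEntry n r (b.1 + n * b.2) (j 1),
          Submodule.subset_span ⟨j 1, ?_, rfl⟩, ?_⟩
        · simp only [hb, Set.mem_Iic]
          rw [Nat.le_div_iff_mul_le hn, mul_comm]
          omega
        · ext1 b'
          rw [hcol, LinearMap.single_apply]
          by_cases hbb : b' = b
          · subst hbb
            rw [Pi.single_eq_same, if_pos hbw.symm]
          · rw [Pi.single_eq_of_ne hbb, if_neg]
            intro he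
            apply hbb
            have e1 : (b'.1 : ℕ) = b.1 := by
              simp only [hb, he, Nat.add_mul_mod_self_left, Nat.mod_eq_of_lt b'.1.2]
            refine Prod.ext (Fin.ext e1) (Fin.ext ?_)
            have : n * (b'.2 : ℕ) = n * b.2 := by omega
            exact Nat.eq_of_mul_eq_mul_left hn this
      · suffices h0 : blockMap n r (A.col j) = 0 by rw [h0]; exact Submodule.zero_mem _
        ext1 b
        rw [hcol, if_neg, Pi.zero_apply]
        intro he
        apply hw
        rw [he, Nat.add_mul_div_left _ _ hn, Nat.div_eq_of_lt b.1.2, zero_add]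
        exact b.2.2
    · refine iSup_le fun b => ?_
      rw [Submodule.map_span, Submodule.span_le]
      rintro _ ⟨_, ⟨i, hi, rfl⟩, rfl⟩
      refine Submodule.subset_span ⟨_, ⟨Finsupp.equivFunOnFinite.symm
        ![b.1 + n * b.2 - n * i, i], rfl⟩, ?_⟩
      have hle : n * i ≤ n * b.2 := Nat.mul_le_mul_left _ hi
      ext1 b'
      rw [hA, blockMap_col, LinearMap.single_apply]
      have e0 : b.1 + n * b.2 - n * i + n * i = b.1 + n * b.2 := by omega
      simp only [Finsupp.equivFunOnFinite_symm_apply_apply, Matrix.cons_val_zero,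
        Matrix.cons_val_one, e0]
      by_cases hbb : b' = b
      · subst hbb
        rw [Pi.single_eq_same, if_pos rfl]
      · rw [Pi.single_eq_of_ne hbb, if_neg]
        intro he
        apply hbb
        have e1 : (b'.1 : ℕ) = b.1 := by
          have := congrArg (· % n) he
          simpa [Nat.add_mul_mod_self_left, Nat.mod_eq_of_lt] using this.symm
        refine Prod.ext (Fin.ext e1) (Fin.ext ?_)
        have : n * (b'.2 : ℕ) = n * b.2 := by omega
        exact Nat.eq_of_mul_eq_mul_left hn this
  rw [← LinearMap.finrank_range_of_inj hinj, hrange, finrank_pi_submodule, Fintype.sum_prod_type,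
    Finset.sum_range]
  exact Finset.sum_congr rfl fun c _ => (Finset.sum_range fun k =>
    Module.finrank (ZMod 2) (Submodule.span (ZMod 2)
      ((fun i => blockEntry n r (c + n * k) i) '' Set.Iic k))).symm

/-- The hypothesis `h0` rules out that the rank is infinite: an infinite `polyRank` has `toNat` equal
to `0`. -/
theorem polyRank_eq_totalRank {n r bits : ℕ} (hn : 0 < n) (hbits : n * 2 ^ r ≤ 2 ^ bits)
    (h0 : totalRank n r bits ≠ 0) :
    polyRank (dPoly n ^ (2 ^ r - 1)) = totalRank n r bits := by
  have h : (polyRank (dPoly n ^ (2 ^ r - 1))).toNat = totalRank n r bits := by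
    rw [polyRank, Matrix.eRank_toNat_eq_finrank, finrank_span_col n r hn, totalRank_eq n r bits hbits]
  have htop : polyRank (dPoly n ^ (2 ^ r - 1)) ≠ ⊤ := by
    intro ht
    rw [ht] at h
    exact h0 h.symm
  rw [← h, ENat.natCast_toNat htop]

/-! ### Separation rank -/

/-- The function `K` of two variables is a sum of `ρ` products of functions of one variable. -/
def HasSepRank {V W F : Type*} [CommSemiring F] (K : V → W → F) (ρ : ℕ) : Prop :=
  ∃ (f : Fin ρ → V → F) (g : Fin ρ → W → F), ∀ u v, K u v = ∑ a, f a u * g a v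

section

variable {V W F : Type*}

theorem HasSepRank.of_fintype [CommSemiring F] {K : V → W → F} {ι : Type*} [Fintype ι]
    (f : ι → V → F) (g : ι → W → F) (h : ∀ u v, K u v = ∑ a, f a u * g a v) :
    HasSepRank K (Fintype.card ι) :=
  ⟨fun a => f ((Fintype.equivFin ι).symm a), fun a => g ((Fintype.equivFin ι).symm a),
    fun u v => by rw [h, ← (Fintype.equivFin ι).symm.sum_comp]⟩

theorem hasSepRank_one [CommSemiring F] : HasSepRank (1 : V → W → F) 1 :=
  ⟨1, 1, by simp⟩

theorem HasSepRank.add [CommSemiring F] {K L : V → W → F} {a b : ℕ} (hK : HasSepRank K a)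
    (hL : HasSepRank L b) : HasSepRank (K + L) (a + b) := by
  obtain ⟨f, g, h⟩ := hK
  obtain ⟨f', g', h'⟩ := hL
  simpa using HasSepRank.of_fintype (ι := Fin a ⊕ Fin b) (K := K + L) (Sum.elim f f')
    (Sum.elim g g') (by simp [h, h'])

theorem HasSepRank.mul [CommSemiring F] {K L : V → W → F} {a b : ℕ} (hK : HasSepRank K a)
    (hL : HasSepRank L b) : HasSepRank (K * L) (a * b) := by
  obtain ⟨f, g, h⟩ := hK
  obtain ⟨f', g', h'⟩ := hL
  simpa using HasSepRank.of_fintype (ι := Fin a × Fin b) (K := K * L)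
    (fun x u => f x.1 u * f' x.2 u) (fun x v => g x.1 v * g' x.2 v) fun u v => by
      simp only [Pi.mul_apply, h, h', Finset.sum_mul_sum, Fintype.sum_prod_type]
      exact Finset.sum_congr rfl fun _ _ => Finset.sum_congr rfl fun _ _ => by ring

/-- The Frobenius endomorphism is additive, so it preserves separation ranks. -/
theorem HasSepRank.pow_char_pow [CommSemiring F] (p : ℕ) [ExpChar F p] {K : V → W → F} {a : ℕ}
    (hK : HasSepRank K a) (e : ℕ) : HasSepRank (K ^ p ^ e) a := by
  obtain ⟨f, g, h⟩ := hK
  refine ⟨fun x u => f x u ^ p ^ e, fun x v => g x v ^ p ^ e, fun u v => ?_⟩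
  simp only [Pi.pow_apply, h, sum_pow_char_pow, mul_pow]

theorem HasSepRank.rank_le [Field F] [Fintype V] {K : V → V → F} {a : ℕ}
    (hK : HasSepRank K a) : (Matrix.of K).rank ≤ a := by
  obtain ⟨f, g, h⟩ := hK
  have : Matrix.of K = Matrix.of (fun u x => f x u) * Matrix.of (fun x v => g x v) := by
    ext u v
    simp [Matrix.mul_apply, h]
  rw [this]
  refine (Matrix.rank_mul_le_left _ _).trans ?_
  simpa using Matrix.rank_le_card_width (Matrix.of fun u x => f x u)

/-- `2 ^ (a + b) - 1 = (2 ^ a - 1) + (2 ^ b - 1) * 2 ^ a`, and the second summand is a Frobenius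
twist. -/
theorem HasSepRank.pow_two_pow_sub_one [CommSemiring F] [CharP F 2] {K : V → W → F} {a b ρ σ : ℕ}
    (ha : HasSepRank (K ^ (2 ^ a - 1)) ρ) (hb : HasSepRank (K ^ (2 ^ b - 1)) σ) :
    HasSepRank (K ^ (2 ^ (a + b) - 1)) (ρ * σ) := by
  have : ExpChar F 2 := ExpChar.prime Nat.prime_two
  have he : 2 ^ (a + b) - 1 = (2 ^ a - 1) + (2 ^ b - 1) * 2 ^ a := by
    rw [pow_add, Nat.sub_mul, mul_comm (2 ^ b), one_mul]
    have h1 : 1 ≤ 2 ^ a := Nat.one_le_two_pow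
    have h2 : 2 ^ a ≤ 2 ^ a * 2 ^ b := Nat.le_mul_of_pos_right _ (by positivity)
    omega
  rw [he, pow_add, pow_mul]
  exact ha.mul (hb.pow_char_pow 2 a)

theorem HasSepRank.pow_two_pow_mul_sub_one [CommSemiring F] [CharP F 2] {K : V → W → F} {r ρ : ℕ}
    (h : HasSepRank (K ^ (2 ^ r - 1)) ρ) (k : ℕ) :
    HasSepRank (K ^ (2 ^ (r * k) - 1)) (ρ ^ k) := by
  induction k with
  | zero => simpa using hasSepRank_one
  | succ k ih => exact ih.pow_two_pow_sub_one h

end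

theorem aeval_sumElim_eq {F : Type*} [Field F] [Algebra (ZMod 2) F] (h : Poly) (u v : Fin 2 → F) :
    MvPolynomial.aeval (Sum.elim u v) h = ∑ m ∈ h.support,
      algebraMap (ZMod 2) F (MvPolynomial.coeff m h) * (∏ x, u x ^ m (Sum.inl x)) *
        ∏ x, v x ^ m (Sum.inr x) := by
  rw [MvPolynomial.aeval_def, MvPolynomial.eval₂_eq']
  refine Finset.sum_congr rfl fun m _ => ?_
  rw [Fintype.prod_sum_type, mul_assoc]
  rfl

/-- The trivial bound, one product for each monomial. -/
theorem hasSepRank_aeval_card {F : Type*} [Field F] [Algebra (ZMod 2) F] (h : Poly) :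
    HasSepRank (fun u v : Fin 2 → F => MvPolynomial.aeval (Sum.elim u v) h) h.support.card := by
  have := HasSepRank.of_fintype (ι := h.support)
    (K := fun u v : Fin 2 → F => MvPolynomial.aeval (Sum.elim u v) h)
    (fun m u => algebraMap (ZMod 2) F (MvPolynomial.coeff m.1 h) * (∏ x, u x ^ m.1 (Sum.inl x)))
    (fun m v => ∏ x, v x ^ m.1 (Sum.inr x)) fun u v => by
      rw [aeval_sumElim_eq, ← Finset.sum_coe_sort]
  simpa using this

/-- A basis of the column space of the coefficient matrix expresses the values of `h` as a sum of
`rank h` separated products. -/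
theorem hasSepRank_aeval {F : Type*} [Field F] [Algebra (ZMod 2) F] {h : Poly} {ρ : ℕ}
    (hρ : polyRank h = ρ) :
    HasSepRank (fun u v : Fin 2 → F => MvPolynomial.aeval (Sum.elim u v) h) ρ := by
  classical
  set A := coeffMatrix h with hA
  set S := Submodule.span (ZMod 2) (Set.range A.col) with hS
  have hrank : Module.rank (ZMod 2) S = (ρ : Cardinal) := by
    rwa [polyRank, Matrix.eRank, Cardinal.toENat_eq_natCast] at hρ
  have hfr : Module.finrank (ZMod 2) S = ρ := Module.finrank_eq_of_rank_eq hrank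
  have : Module.Finite (ZMod 2) S := Module.finite_of_rank_eq_nat hrank
  let b := Module.finBasisOfFinrankEq (ZMod 2) S hfr
  have hmem (j) : A.col j ∈ S := Submodule.subset_span ⟨j, rfl⟩
  let c : (Fin 2 →₀ ℕ) → Fin ρ → ZMod 2 := fun j a => b.repr ⟨A.col j, hmem j⟩ a
  have hc (i j) : A i j = ∑ a, (b a : (Fin 2 →₀ ℕ) → ZMod 2) i * c j a := by
    have := congrArg (fun x : S => (x : (Fin 2 →₀ ℕ) → ZMod 2) i)
      (b.sum_repr ⟨A.col j, hmem j⟩)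
    simp only [Submodule.coe_sum, Submodule.coe_smul, Finset.sum_apply, Pi.smul_apply,
      smul_eq_mul, Matrix.col_apply] at this
    rw [← this]
    exact Finset.sum_congr rfl fun a _ => mul_comm _ _
  let e := Finsupp.sumFinsuppEquivProdFinsupp (α := Fin 2) (β := Fin 2) (γ := ℕ)
  let I := h.support.image fun m => (e m).1
  let J := h.support.image fun m => (e m).2
  refine ⟨fun a u => ∑ i ∈ I, algebraMap (ZMod 2) F ((b a : (Fin 2 →₀ ℕ) → ZMod 2) i) *
      ∏ x, u x ^ i x,
    fun a v => ∑ j ∈ J, algebraMap (ZMod 2) F (c j a) * ∏ x, v x ^ j x, fun u v => ?_⟩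
  have h1 : MvPolynomial.aeval (Sum.elim u v) h = ∑ ij ∈ I ×ˢ J,
      algebraMap (ZMod 2) F (A ij.1 ij.2) * (∏ x, u x ^ ij.1 x) * ∏ x, v x ^ ij.2 x := by
    rw [aeval_sumElim_eq]
    have h2 : (h.support.map e.toEmbedding) ⊆ I ×ˢ J := by
      intro x hx
      obtain ⟨m, hm, rfl⟩ := Finset.mem_map.1 hx
      exact Finset.mem_product.2 ⟨Finset.mem_image_of_mem _ hm, Finset.mem_image_of_mem _ hm⟩
    rw [← Finset.sum_subset h2, Finset.sum_map]
    · refine Finset.sum_congr rfl fun m _ => ?_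
      have : A (e m).1 (e m).2 = MvPolynomial.coeff m h :=
        congrArg (fun m => MvPolynomial.coeff m h) (e.symm_apply_apply m)
      simp only [Equiv.coe_toEmbedding, this]
      rfl
    · intro x _ hx
      have : A x.1 x.2 = 0 := by
        by_contra hne
        exact hx (Finset.mem_map.2 ⟨e.symm x, MvPolynomial.mem_support_iff.2 hne,
          e.apply_symm_apply x⟩)
      rw [this, map_zero, zero_mul, zero_mul]
  dsimp only
  rw [h1, Finset.sum_product]
  conv_rhs =>
    simp only [Finset.sum_mul_sum]
    rw [Finset.sum_comm]
  refine Finset.sum_congr rfl fun i _ => ?_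
  conv_rhs => rw [Finset.sum_comm]
  refine Finset.sum_congr rfl fun j _ => ?_
  rw [hc, map_sum, Finset.sum_mul, Finset.sum_mul]
  refine Finset.sum_congr rfl fun a _ => ?_
  rw [map_mul]
  ring

/-- Extension of scalars does not decrease ranks: it preserves the rank normal form. -/
theorem rank_le_rank_map {K L : Type*} [Field K] [Field L] (φ : K →+* L) {V : Type*} [Fintype V]
    [DecidableEq V] (M : Matrix V V K) : M.rank ≤ (M.map φ).rank := by
  obtain ⟨P, Q, e, -, -, h⟩ := M.exists_rank_normal_form
  have h1 := congrArg (fun X => ((X.map φ).submatrix (fun i => e.symm (Sum.inl i))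
    (fun i => e.symm (Sum.inl i)) : Matrix (Fin M.rank) (Fin M.rank) L)) h
  simp only [Matrix.map_mul] at h1
  have h2 : ((((Matrix.fromBlocks 1 0 0 0).submatrix e e : Matrix V V K).map φ).submatrix
      (fun i => e.symm (Sum.inl i)) (fun i => e.symm (Sum.inl i)) :
        Matrix (Fin M.rank) (Fin M.rank) L) = 1 := by
    ext i j
    simp [Matrix.one_apply, apply_ite φ]
  rw [h2] at h1
  have h3 := congrArg Matrix.rank h1
  rw [Matrix.rank_one, Fintype.card_fin] at h3
  rw [← h3]
  exact (Matrix.rank_submatrix_le _ _ _).trans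
    ((Matrix.rank_mul_le_left _ _).trans (Matrix.rank_mul_le_right _ _))

/-! ### The rate of the codes -/

/-- The matrix `A + I` is the indicator of the zero set of `(x₁ + y₁) ^ n + x₂ + y₂`; the identity
matrix accounts for the diagonal, which the Cayley graph omits. -/
theorem parityCheck_bchGraph_apply {F : Type*} [Field F] [CharP F 2] [DecidableEq (F × F)]
    [DecidableEq F] {n : ℕ} [DecidableRel (bchGraph F n).Adj] (hn : n ≠ 0) (u v : F × F) :
    parityCheck (bchGraph F n) u v = if (u.1 + v.1) ^ n + u.2 + v.2 = 0 then 1 else 0 := by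
  have hcurve (x y : F × F) (hxy : x ≠ y) : (∃ g ∈ powerCurve F n \ {0}, x + g = y) ↔
      (x.1 + y.1) ^ n + x.2 + y.2 = 0 := by
    have hs (z : F) : -z = z := CharTwo.neg_eq z
    constructor
    · rintro ⟨g, ⟨⟨a, rfl⟩, -⟩, rfl⟩
      have e1 : x.1 + (x.1 + a) = a := by rw [← add_assoc, CharTwo.add_self_eq_zero, zero_add]
      have e2 : a ^ n + x.2 + (x.2 + a ^ n) = 0 := by
        rw [add_comm (a ^ n) x.2]; exact CharTwo.add_self_eq_zero _
      simpa [e1] using e2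
    · intro h
      refine ⟨y - x, ⟨⟨y.1 - x.1, Prod.ext rfl ?_⟩, ?_⟩, by simp⟩
      · rw [add_assoc, add_eq_zero_iff_eq_neg, hs] at h
        simp only [Prod.snd_sub, CharTwo.sub_eq_add]
        rw [add_comm y.1, h, add_comm]
      · simpa [sub_eq_zero] using hxy.symm
  rw [parityCheck, Matrix.add_apply, SimpleGraph.adjMatrix_apply, Matrix.one_apply]
  by_cases huv : u = v
  · subst huv
    simp [CharTwo.add_self_eq_zero, hn]
  · rw [if_neg huv, add_zero]
    refine if_congr ?_ rfl rfl
    rw [bchGraph, SimpleGraph.addCayley_adj']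
    rw [← hcurve u v huv]
    constructor
    · rintro ⟨-, g, hg, h | h⟩
      · exact ⟨g, hg, h⟩
      · rw [hcurve u v huv, add_comm u.1, add_assoc, add_comm u.2, ← add_assoc,
          ← hcurve v u (Ne.symm huv)]
        exact ⟨g, hg, h.symm⟩
    · rintro ⟨g, hg, h⟩
      exact ⟨huv, g, hg, Or.inl h⟩

theorem aeval_dPoly {F : Type*} [Field F] [Algebra (ZMod 2) F] (n : ℕ) (u v : Fin 2 → F) :
    MvPolynomial.aeval (Sum.elim u v) (dPoly n) = (u 0 + v 0) ^ n + u 1 + v 1 := by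
  simp [dPoly]

/-- Over a field with `q = 2 ^ m` elements the indicator of the zero set of `d` is
`1 + d ^ (q - 1)`, so the rank of the parity-check matrix exceeds the separation rank of
`d ^ (q - 1)` by at most one. -/
theorem rank_parityCheck_bchGraph_le {F : Type*} [Field F] [Fintype F] [Algebra (ZMod 2) F]
    [DecidableEq (F × F)] {n m ρ : ℕ} [DecidableRel (bchGraph F n).Adj] (hn : n ≠ 0)
    (hF : Fintype.card F = 2 ^ m)
    (h : HasSepRank ((fun u v : Fin 2 → F => MvPolynomial.aeval (Sum.elim u v) (dPoly n)) ^
      (2 ^ m - 1)) ρ) :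
    (parityCheck (bchGraph F n)).rank ≤ 1 + ρ := by
  classical
  have : CharP F 2 := charP_of_injective_algebraMap (algebraMap (ZMod 2) F).injective 2
  have hK : HasSepRank (fun u v : F × F => (1 : F) + ((u.1 + v.1) ^ n + u.2 + v.2) ^ (2 ^ m - 1))
      (1 + ρ) := by
    refine (hasSepRank_one (V := F × F) (W := F × F)).add ?_
    obtain ⟨f, g, hfg⟩ := h
    refine ⟨fun a u => f a ![u.1, u.2], fun a v => g a ![v.1, v.2], fun u v => ?_⟩
    rw [← hfg]
    simp [aeval_dPoly]
  refine (rank_le_rank_map (algebraMap (ZMod 2) F) _).trans (le_trans (le_of_eq ?_) hK.rank_le)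
  congr 1
  ext u v
  rw [Matrix.map_apply, parityCheck_bchGraph_apply hn, Matrix.of_apply]
  split_ifs with h0
  · have hm : 2 ^ m - 1 ≠ 0 := by
      have : 1 < 2 ^ m := hF ▸ Fintype.one_lt_card
      omega
    rw [h0, zero_pow hm, add_zero, map_one]
  · rw [← hF, FiniteField.pow_card_sub_one_eq_one _ h0, map_zero, CharTwo.add_self_eq_zero]

theorem rate_code {V : Type*} [Fintype V] [DecidableEq V] [Nonempty V] (Γ : SimpleGraph V)
    [DecidableRel Γ.Adj] : rate (code Γ) = 1 - (parityCheck Γ).rank / Fintype.card V := by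
  have h := LinearMap.finrank_range_add_finrank_ker (parityCheck Γ).mulVecLin
  have hV : (Fintype.card V : ℝ) ≠ 0 := Nat.cast_ne_zero.2 Fintype.card_ne_zero
  rw [rate, code]
  rw [Module.finrank_fintype_fun_eq_card] at h ⊢
  rw [eq_sub_iff_add_eq, ← add_div, div_eq_one_iff_eq hV]
  rw [← h, Matrix.rank]
  push_cast
  ring

/-- Writing `m = r k + l` with `l < r`, the exponent `2 ^ m - 1` splits into `k` Frobenius twists of
`2 ^ r - 1` and `l` Frobenius twists of `1`; the former contribute a factor `ρ` each, the latter a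
factor bounded by the number of monomials of `d`. -/
theorem abs_rate_bchCode_sub_one_le {n r ρ s m : ℕ} (hn : n ≠ 0) (hm : m ≠ 0) (hr : 0 < r)
    (hρ : polyRank (dPoly n ^ (2 ^ r - 1)) = ρ) (hs : (dPoly n).support.card ≤ s) (hs1 : 1 ≤ s) :
    |rate (bchCode n m) - 1| ≤ (1 / 4) ^ m + s ^ r * (ρ / 4 ^ r : ℝ) ^ (m / r) := by
  classical
  let F := GaloisField 2 m
  let _ : Fintype F := Fintype.ofFinite _
  have hF : Fintype.card F = 2 ^ m := by
    rw [← Nat.card_eq_fintype_card]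
    exact GaloisField.card 2 m hm
  set K : (Fin 2 → F) → (Fin 2 → F) → F :=
    fun u v => MvPolynomial.aeval (Sum.elim u v) (dPoly n) with hK
  have h1 : HasSepRank (K ^ (2 ^ r - 1)) ρ := by
    have := hasSepRank_aeval (F := F) hρ
    simp only [map_pow] at this
    exact this
  have h2 : HasSepRank (K ^ (2 ^ 1 - 1)) (dPoly n).support.card := by
    simpa using hasSepRank_aeval_card (F := F) (dPoly n)
  have h3 := (h1.pow_two_pow_mul_sub_one (m / r)).pow_two_pow_sub_one
    (h2.pow_two_pow_mul_sub_one (m % r))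
  rw [one_mul, Nat.div_add_mod] at h3
  have h4 := rank_parityCheck_bchGraph_le hn hF h3
  have h5 : rate (bchCode n m) = 1 - (parityCheck (bchGraph F n)).rank / Fintype.card (F × F) :=
    rate_code _
  have hcard : (Fintype.card (F × F) : ℝ) = 4 ^ m := by
    rw [Fintype.card_prod, hF]
    push_cast
    rw [← mul_pow]
    norm_num
  rw [h5, hcard, sub_sub_cancel_left, abs_neg, abs_of_nonneg (by positivity)]
  have h6 : ((parityCheck (bchGraph F n)).rank : ℝ) ≤ 1 + ρ ^ (m / r) * s ^ r := by
    have : (parityCheck (bchGraph F n)).rank ≤ 1 + ρ ^ (m / r) * s ^ r := by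
      refine h4.trans (Nat.add_le_add_left (Nat.mul_le_mul_left _ ?_) _)
      exact (Nat.pow_le_pow_left hs _).trans (Nat.pow_le_pow_right hs1 (Nat.mod_lt _ hr).le)
    exact_mod_cast this
  have h7 : (4 : ℝ) ^ (r * (m / r)) ≤ 4 ^ m :=
    pow_le_pow_right₀ (by norm_num) (Nat.mul_div_le _ _)
  calc ((parityCheck (bchGraph F n)).rank : ℝ) / 4 ^ m
      ≤ (1 + ρ ^ (m / r) * s ^ r) / 4 ^ m := by gcongr
    _ = (1 / 4) ^ m + ρ ^ (m / r) * s ^ r / 4 ^ m := by rw [add_div, one_div_pow]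
    _ ≤ (1 / 4) ^ m + ρ ^ (m / r) * s ^ r / 4 ^ (r * (m / r)) := by gcongr
    _ = _ := by rw [div_pow (ρ : ℝ), ← pow_mul]; ring

/-- A single exponent `r` with `rank (d ^ (2 ^ r - 1)) < 4 ^ r` forces the rates to tend to `1`. -/
theorem isUnitRate_of_polyRank_lt {n r ρ : ℕ} (hn : n ≠ 0) (hr : 0 < r)
    (hρ : polyRank (dPoly n ^ (2 ^ r - 1)) = ρ) (hlt : ρ < 4 ^ r) : IsUnitRate n := by
  rw [IsUnitRate, tendsto_iff_dist_tendsto_zero]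
  set s := (dPoly n).support.card + 1 with hs
  have hρ1 : (ρ / 4 ^ r : ℝ) < 1 := by
    rw [div_lt_one (by positivity)]
    exact_mod_cast hlt
  have hlim : Tendsto (fun m : ℕ => (1 / 4 : ℝ) ^ m + s ^ r * (ρ / 4 ^ r : ℝ) ^ (m / r)) atTop
      (𝓝 (0 + s ^ r * 0)) := by
    refine (tendsto_pow_atTop_nhds_zero_of_lt_one (by norm_num) (by norm_num)).add
      (Tendsto.const_mul _ ?_)
    exact (tendsto_pow_atTop_nhds_zero_of_lt_one (by positivity) hρ1).comp
      (Nat.tendsto_div_const_atTop hr.ne')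
  rw [mul_zero, add_zero] at hlim
  refine squeeze_zero' (Eventually.of_forall fun _ => dist_nonneg) ?_ hlim
  filter_upwards [eventually_ne_atTop 0] with m hm
  exact abs_rate_bchCode_sub_one_le hn hm hr hρ (Nat.le_succ _) (Nat.succ_pos _)

/-! ### The three ranks -/

theorem totalRank_seven : totalRank 7 6 9 = 3256 :=
  Nat.eq_of_beq_eq_true (by decide +kernel)

theorem totalRank_eleven : totalRank 11 7 11 = 15018 :=
  Nat.eq_of_beq_eq_true (by decide +kernel)

theorem totalRank_thirteen : totalRank 13 7 11 = 14442 :=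
  Nat.eq_of_beq_eq_true (by decide +kernel)

theorem polyRank_dPoly_seven : polyRank (dPoly 7 ^ (2 ^ 6 - 1)) = (3256 : ℕ) := by
  have h := totalRank_seven
  rw [polyRank_eq_totalRank (bits := 9) (by norm_num) (by norm_num) (by rw [h]; norm_num), h]

theorem polyRank_dPoly_eleven : polyRank (dPoly 11 ^ (2 ^ 7 - 1)) = (15018 : ℕ) := by
  have h := totalRank_eleven
  rw [polyRank_eq_totalRank (bits := 11) (by norm_num) (by norm_num) (by rw [h]; norm_num), h]

theorem polyRank_dPoly_thirteen : polyRank (dPoly 13 ^ (2 ^ 7 - 1)) = (14442 : ℕ) := by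
  have h := totalRank_thirteen
  rw [polyRank_eq_totalRank (bits := 11) (by norm_num) (by norm_num) (by rw [h]; norm_num), h]

end StorageCode

theorem mainTheorem8 :
    (StorageCode.polyRank (StorageCode.dPoly 7 ^ (2 ^ 6 - 1)) = 3256 ∧
      StorageCode.polyRank (StorageCode.dPoly 7 ^ (2 ^ 6 - 1)) < 4 ^ 6) ∧
    (StorageCode.polyRank (StorageCode.dPoly 11 ^ (2 ^ 7 - 1)) = 15018 ∧
      StorageCode.polyRank (StorageCode.dPoly 11 ^ (2 ^ 7 - 1)) < 4 ^ 7) ∧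
    (StorageCode.polyRank (StorageCode.dPoly 13 ^ (2 ^ 7 - 1)) = 14442 ∧
      StorageCode.polyRank (StorageCode.dPoly 13 ^ (2 ^ 7 - 1)) < 4 ^ 7) ∧
    StorageCode.IsUnitRate 7 ∧ StorageCode.IsUnitRate 11 ∧ StorageCode.IsUnitRate 13 := by
  have h7 := StorageCode.polyRank_dPoly_seven
  have h11 := StorageCode.polyRank_dPoly_eleven
  have h13 := StorageCode.polyRank_dPoly_thirteen
  refine ⟨⟨h7, ?_⟩, ⟨h11, ?_⟩, ⟨h13, ?_⟩,
    StorageCode.isUnitRate_of_polyRank_lt (by norm_num) (by norm_num) h7 (by norm_num),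
    StorageCode.isUnitRate_of_polyRank_lt (by norm_num) (by norm_num) h11 (by norm_num),
    StorageCode.isUnitRate_of_polyRank_lt (by norm_num) (by norm_num) h13 (by norm_num)⟩
  · rw [h7]; exact_mod_cast (by norm_num : 3256 < 4 ^ 6)
  · rw [h11]; exact_mod_cast (by norm_num : 15018 < 4 ^ 7)
  · rw [h13]; exact_mod_cast (by norm_num : 14442 < 4 ^ 7)
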